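/- A right-preordered group is a (not necessarily abelian) group $(G,0,+)$ with a preorder $\leq$ such that $g\leq h$ implies $g+k\leq h+k$ for all $g,h,k\in G$; its positive cone $P_G=\{g\in G : 0\leq g\}$ is a submonoid of $G$. Let $\mathbf{RPOGrp}$ be the category of right-preordered groups and monotone group morphisms; it is pointed and finitely complete. A split epimorphism of monoids $d:M\to N$ with section $e$ and kernel $K$ is a Schreier point if there is a unique map of sets $s:M\to K$ such that $m=s(m)+ed(m)$ for all $m\in M$. Let $\mathcal S$ be the class of all split epimorphisms $(d,e)$ in $\mathbf{RPOGrp}$ for which the induced split epimorphism of monoids between the positive cones is a Schreier point. An equivalence relation $R$ on an object $X$, with projections $p_0^R,p_1^R:R\to X$ and diagonal $\Delta_R:X\to R$, is effective if it is the kernel pair of some morphism, and $\mathcal S$-effective if moreover both split epimorphisms $(p_0^R,\Delta_R)$ and $(p_1^R,\Delta_R)$ belong to $\mathcal S$. Its normalization is the subobject $\ker(p_0^R)\to R\xrightarrow{p_1^R}X$ of $X$. Two equivalence relations $R,S$ on $X$ commute in the sense of Smith if there is a morphism $p:R\times_XS\to X$, where $R\times_XS$ is the pullback of $p_1^R$ and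 $p_0^S$, such that $p\circ(\Delta_R p_0^S,1_S)=p_1^S$ and $p\circ(1_R,\Delta_S p_1^R)=p_0^R$. Two subobjects $a:A\to Z$ and $b:B\to Z$ commute in the sense of Huq if there is a morphism $\varphi:A\times B\to Z$ such that $\varphi\circ(1_A,0)=a$ and $\varphi\circ(0,1_B)=b$. Theorem. (1) The class $\mathcal S$ is closed under composition: if $(d,e)$ with $d:X\to Y$ and $(d',e')$ with $d':Y\to Z$ belong to $\mathcal S$, then so does $(d'd,ee')$. (2) The class $\mathcal S$ contains every product projection $X\times Y\to Y$ split by $(0,1_Y):Y\to X\times Y$. (3) ($\mathcal S$-Smith-is-Huq) For every object $X$ of $\mathbf{RPOGrp}$ and all $\mathcal S$-effective equivalence relations $R,S$ on $X$, the relations $R$ and $S$ commute in the sense of Smith if and only if their normalizations commute in the sense of Huq. -/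

import Mathlib

open CategoryTheory CategoryTheory.Limits

universe u v w

/-! ### Commutation of relations and subobjects in a pointed, finitely complete category -/

section General

/-- A class of split epimorphisms of `C`: a predicate on pairs consisting of a morphism `d`
and a chosen section `e` of `d`. -/
abbrev SplitEpiClass (C : Type w) [Category.{v} C] :=
  ∀ ⦃X Y : C⦄ (d : X ⟶ Y), SplitEpi d → Prop

/-- The class `S` is closed under composition of split epimorphisms. -/
def SplitEpiClass.ClosedUnderComp {C : Type w} [Category.{v} C] (S : SplitEpiClass C) : Prop :=
  ∀ ⦃X Y Z : C⦄ (d : X ⟶ Y) (d' : Y ⟶ Z) (s : SplitEpi d) (s' : SplitEpi d'),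
    S d s → S d' s' → S (d ≫ d') (s.comp s')

/-- The class `S` contains every product projection `p₁ : X × Y ⟶ Y`, split by
`i = (0, 1) : Y ⟶ X × Y`; here `P = X × Y` is any categorical product of `X` and `Y`. -/
def SplitEpiClass.ContainsProductProjections {C : Type w} [Category.{v} C]
    [HasZeroMorphisms C] (S : SplitEpiClass C) : Prop :=
  ∀ ⦃X Y P : C⦄ (p₀ : P ⟶ X) (p₁ : P ⟶ Y), Nonempty (IsLimit (BinaryFan.mk p₀ p₁)) →
    ∀ (i : Y ⟶ P) (_ : i ≫ p₀ = 0) (h₁ : i ≫ p₁ = 𝟙 Y), S p₁ ⟨i, h₁⟩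

/-- A reflexive relation on `X`: a jointly monic pair `p₀, p₁ : obj ⟶ X` with a common
section `diag`. -/
structure ReflRel {C : Type w} [Category.{v} C] (X : C) where
  obj : C
  p₀ : obj ⟶ X
  p₁ : obj ⟶ X
  diag : X ⟶ obj
  diag_p₀ : diag ≫ p₀ = 𝟙 X
  diag_p₁ : diag ≫ p₁ = 𝟙 X
  jointly_monic : ∀ {T : C} (a b : T ⟶ obj), a ≫ p₀ = b ≫ p₀ → a ≫ p₁ = b ≫ p₁ → a = b

/-- The relation induced on generalized elements `T ⟶ X` by a relation on `X`. -/
def ReflRel.Related {C : Type w} [Category.{v} C] {X : C} (R : ReflRel X) {T : C}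
    (a b : T ⟶ X) : Prop :=
  ∃ t : T ⟶ R.obj, t ≫ R.p₀ = a ∧ t ≫ R.p₁ = b

/-- An (internal) equivalence relation on `X`: a relation which induces an equivalence
relation on the generalized elements `T ⟶ X`, for every `T`. -/
structure EquivRel {C : Type w} [Category.{v} C] (X : C) extends ReflRel X where
  equivalence : ∀ T : C, Equivalence (fun a b : T ⟶ X => toReflRel.Related a b)

/-- An equivalence relation is effective if it is the kernel pair of some morphism. -/
def EquivRel.IsEffective {C : Type w} [Category.{v} C] {X : C} (R : EquivRel X) : Prop :=
  ∃ (Y : C) (f : X ⟶ Y), IsKernelPair f R.p₀ R.p₁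

/-- An `S`-effective equivalence relation: an effective equivalence relation both of whose
underlying split epimorphisms `(p₀, diag)` and `(p₁, diag)` belong to `S`. -/
def EquivRel.IsClassEffective {C : Type w} [Category.{v} C] (S : SplitEpiClass C) {X : C}
    (R : EquivRel X) : Prop :=
  R.IsEffective ∧ S R.p₀ ⟨R.diag, R.diag_p₀⟩ ∧ S R.p₁ ⟨R.diag, R.diag_p₁⟩

/-- Two reflexive relations `R`, `S` on `X` commute in the sense of Smith: on the pullback
`R ×[X] S` of `p₁ : R ⟶ X` and `p₀ : S ⟶ X` there is a morphism `p` to `X` such that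
`p (x, y, y) = x` for `(x, y)` in `R` and `p (y, y, z) = z` for `(y, z)` in `S`. -/
def SmithCommute {C : Type w} [Category.{v} C] [HasFiniteLimits C] {X : C}
    (R S : ReflRel X) : Prop :=
  ∃ p : pullback R.p₁ S.p₀ ⟶ X,
    pullback.lift (S.p₀ ≫ R.diag) (𝟙 S.obj)
        (by rw [Category.assoc, R.diag_p₁, Category.comp_id, Category.id_comp]) ≫ p = S.p₁ ∧
    pullback.lift (𝟙 R.obj) (R.p₁ ≫ S.diag)
        (by rw [Category.assoc, S.diag_p₀, Category.comp_id, Category.id_comp]) ≫ p = R.p₀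

/-- Two subobjects `A`, `B` of `Z` commute in the sense of Huq: there is a morphism
`A × B ⟶ Z` which restricts to the inclusions of `A` and of `B`. -/
def HuqCommute {C : Type w} [Category.{v} C] [HasFiniteLimits C] [HasZeroMorphisms C] {Z : C}
    (A B : Subobject Z) : Prop :=
  ∃ φ : (A : C) ⨯ (B : C) ⟶ Z,
    prod.lift (𝟙 (A : C)) (0 : (A : C) ⟶ (B : C)) ≫ φ = A.arrow ∧
    prod.lift (0 : (B : C) ⟶ (A : C)) (𝟙 (B : C)) ≫ φ = B.arrow

theorem EquivRel.mono_normalization {C : Type w} [Category.{v} C] [HasFiniteLimits C]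
    [HasZeroMorphisms C] {X : C} (R : EquivRel X) : Mono (kernel.ι R.p₀ ≫ R.p₁) :=
  ⟨fun a b h => by
    rw [← cancel_mono (kernel.ι R.p₀)]
    apply R.jointly_monic
    · simp
    · simpa using h⟩

/-- The normalization of an equivalence relation `R` on `X`: the kernel of `p₀ : R ⟶ X`, as a
subobject of `X` by means of `p₁ : R ⟶ X`. -/
noncomputable def EquivRel.normalization {C : Type w} [Category.{v} C] [HasFiniteLimits C]
    [HasZeroMorphisms C] {X : C} (R : EquivRel X) : Subobject X :=
  haveI := R.mono_normalization
  Subobject.mk (kernel.ι R.p₀ ≫ R.p₁)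

/-- The `S`-Smith-is-Huq property: two `S`-effective equivalence relations on the same object
commute in the sense of Smith iff their normalizations commute in the sense of Huq. -/
def SplitEpiClass.SmithIsHuq {C : Type w} [Category.{v} C] [HasFiniteLimits C]
    [HasZeroMorphisms C] (S : SplitEpiClass C) : Prop :=
  ∀ ⦃X : C⦄ (R T : EquivRel X), R.IsClassEffective S → T.IsClassEffective S →
    (SmithCommute R.toReflRel T.toReflRel ↔ HuqCommute R.normalization T.normalization)

end General

/-! ### The category of right-preordered groups -/

/-- A right-preordered group: a (not necessarily abelian) group, written additively, with a
preorder such that `g ≤ h` implies `g + k ≤ h + k`. -/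
structure RPOGrp : Type (u + 1) where
  carrier : Type u
  [group : AddGroup carrier]
  [preorder : Preorder carrier]
  [rightMono : AddRightMono carrier]

attribute [instance] RPOGrp.group RPOGrp.preorder RPOGrp.rightMono

/-- A split epimorphism of monoids `d : M → N` with section `e` and kernel `K` is a Schreier
point if there is a unique map of sets `s : M → K` with `m = s m + e (d m)` for all `m`. -/
def IsSchreierPoint {M N : Type*} [AddMonoid M] [AddMonoid N] (d : M →+ N) (e : N →+ M) :
    Prop :=
  ∃! s : M → AddMonoidHom.mker d, ∀ m : M, m = (s m : M) + e (d m)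

namespace RPOGrp

instance : CoeSort RPOGrp.{u} (Type u) := ⟨RPOGrp.carrier⟩

/-- Morphisms of right-preordered groups: monotone group morphisms. -/
@[ext]
structure Hom (X Y : RPOGrp.{u}) where
  hom' : X →+o Y

instance : Category RPOGrp.{u} where
  Hom X Y := Hom X Y
  id X := ⟨OrderAddMonoidHom.id X⟩
  comp f g := ⟨g.hom'.comp f.hom'⟩

instance : ConcreteCategory RPOGrp.{u} (fun X Y => X →+o Y) where
  hom := Hom.hom'
  ofHom := Hom.mk

/-- The monotone group morphism underlying a morphism. -/
abbrev Hom.hom {X Y : RPOGrp.{u}} (f : X ⟶ Y) : X →+o Y :=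
  ConcreteCategory.hom (C := RPOGrp.{u}) f

theorem hom_ext {X Y : RPOGrp.{u}} {f g : X ⟶ Y} (h : ∀ x : X, Hom.hom f x = Hom.hom g x) :
    f = g :=
  Hom.ext (DFunLike.ext _ _ h)

/-- The trivial group. -/
def zeroObj : RPOGrp.{u} where
  carrier := PUnit
  rightMono := ⟨fun _ _ _ _ => le_rfl⟩

instance : HasZeroMorphisms RPOGrp.{u} where
  zero X Y := ⟨⟨⟨(0 : X →+ Y), fun _ _ _ => le_refl (0 : Y)⟩⟩⟩
  comp_zero _ _ := rfl
  zero_comp _ _ _ f := hom_ext fun _ => map_zero (Hom.hom f)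

theorem isZero_zeroObj : IsZero zeroObj.{u} :=
  (IsZero.iff_id_eq_zero _).2 (hom_ext fun _ => rfl)

instance : HasZeroObject RPOGrp.{u} := ⟨⟨zeroObj, isZero_zeroObj⟩⟩

/-- The fibre product of two morphisms, with the componentwise preorder. -/
def fibreProd {X Y Z : RPOGrp.{u}} (f : X ⟶ Z) (g : Y ⟶ Z) : RPOGrp.{u} where
  carrier := AddMonoidHom.eqLocus
    ((Hom.hom f).toAddMonoidHom.comp (AddMonoidHom.fst X Y))
    ((Hom.hom g).toAddMonoidHom.comp (AddMonoidHom.snd X Y))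
  rightMono := ⟨fun c a b h => by
    have h' : a.1.1 ≤ b.1.1 ∧ a.1.2 ≤ b.1.2 := h
    change a.1.1 + c.1.1 ≤ b.1.1 + c.1.1 ∧ a.1.2 + c.1.2 ≤ b.1.2 + c.1.2
    exact ⟨add_le_add_left h'.1 _, add_le_add_left h'.2 _⟩⟩

def fibreProdFst {X Y Z : RPOGrp.{u}} (f : X ⟶ Z) (g : Y ⟶ Z) : fibreProd f g ⟶ X :=
  ⟨⟨(AddMonoidHom.fst X Y).comp (AddSubgroup.subtype _), fun _ _ h => h.1⟩⟩

def fibreProdSnd {X Y Z : RPOGrp.{u}} (f : X ⟶ Z) (g : Y ⟶ Z) : fibreProd f g ⟶ Y :=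
  ⟨⟨(AddMonoidHom.snd X Y).comp (AddSubgroup.subtype _), fun _ _ h => h.2⟩⟩

theorem fibreProd_isPullback {X Y Z : RPOGrp.{u}} (f : X ⟶ Z) (g : Y ⟶ Z) :
    IsPullback (fibreProdFst f g) (fibreProdSnd f g) f g :=
  ⟨⟨hom_ext fun x => x.2⟩, ⟨PullbackCone.IsLimit.mk _
    (fun s => ⟨⟨((Hom.hom s.fst).toAddMonoidHom.prod (Hom.hom s.snd).toAddMonoidHom).codRestrict _
        (fun t => congrArg (fun k => Hom.hom k t) s.condition),
      fun _ _ h => ⟨(Hom.hom s.fst).monotone' h, (Hom.hom s.snd).monotone' h⟩⟩⟩)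
    (fun _ => rfl) (fun _ => rfl)
    (fun _ _ h₁ h₂ => hom_ext fun t => Subtype.ext (Prod.ext
      (congrArg (fun k => Hom.hom k t) h₁) (congrArg (fun k => Hom.hom k t) h₂)))⟩⟩

instance : HasPullbacks RPOGrp.{u} :=
  haveI (X Y Z : RPOGrp.{u}) (f : X ⟶ Z) (g : Y ⟶ Z) : HasLimit (cospan f g) :=
    (fibreProd_isPullback f g).hasPullback
  hasPullbacks_of_hasLimit_cospan _

instance : HasFiniteLimits RPOGrp.{u} :=
  haveI : HasTerminal RPOGrp.{u} := HasZeroObject.hasTerminal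
  hasFiniteLimits_of_hasTerminal_and_pullbacks

/-- The positive cone of a right-preordered group, a submonoid. -/
def posCone (X : RPOGrp.{u}) : AddSubmonoid X where
  carrier := {x | 0 ≤ x}
  zero_mem' := le_refl (0 : X)
  add_mem' {a b} ha hb := by
    have h : 0 + b ≤ a + b := add_le_add_left ha b
    rw [zero_add] at h
    exact le_trans hb h

/-- The monoid morphism induced on positive cones. -/
def posMap {X Y : RPOGrp.{u}} (f : X ⟶ Y) : X.posCone →+ Y.posCone :=
  ((Hom.hom f).toAddMonoidHom.comp X.posCone.subtype).codRestrict Y.posCone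
    (fun a => map_nonneg (Hom.hom f) a.2)

/-- The class of Schreier split epimorphisms of right-preordered groups: those which induce a
Schreier point of monoids on the positive cones. -/
def schreier : SplitEpiClass RPOGrp.{u} :=
  fun _ _ d s => IsSchreierPoint (posMap d) (posMap s.section_)

end RPOGrp

/-! Everything rests on `schreier_iff`: in a group, `m = s m + e (d m)` forces `s m = m - e (d m)`,
so being Schreier only says that this difference is positive, i.e. `e (d m) ≤ m` for `m ≥ 0`.
Composition and product projections then reduce to short order arguments.

Smith implies Huq formally: set `φ (a, b) = p (a, 0, b)`. Conversely, the only candidate is the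
Mal'tsev operation `p (x, y, z) = x - y + z`. If `R` and `S` are the kernel pairs of `f` and `g`,
then `x - y` lies in `ker f` and `-y + z` in `ker g`; Huq commutation makes these kernels commute
elementwise, so `p` is additive (`sub_add_add_of_commute`). The Schreier inequality for `R.p₁` makes
`p` preserve positive elements, hence monotone. -/

/-! ### Normalizations, and Smith implies Huq -/

/-- The normalization of `R`, as an object, is the kernel of `R.p₀`. -/
theorem EquivRel.exists_iso_kernel {C : Type w} [Category.{v} C] [HasFiniteLimits C]
    [HasZeroMorphisms C] {X : C} (R : EquivRel X) :
    ∃ e : kernel R.p₀ ≅ (R.normalization : C),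
      e.hom ≫ R.normalization.arrow = kernel.ι R.p₀ ≫ R.p₁ := by
  have := R.mono_normalization
  exact ⟨(Subobject.underlyingIso (kernel.ι R.p₀ ≫ R.p₁)).symm,
    Subobject.underlyingIso_arrow _⟩

/-- If `R` is the kernel pair of `f`, every morphism killed by `f` factors through the
normalization of `R`. -/
theorem EquivRel.exists_comp_arrow_normalization {C : Type w} [Category.{v} C]
    [HasFiniteLimits C] [HasZeroMorphisms C] {X Y T : C} (R : EquivRel X) {f : X ⟶ Y}
    (hf : IsKernelPair f R.p₀ R.p₁) (k : T ⟶ X) (hk : k ≫ f = 0) :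
    ∃ t : T ⟶ (R.normalization : C), t ≫ R.normalization.arrow = k := by
  obtain ⟨e, he⟩ := R.exists_iso_kernel
  -- The pair `(0, k)`, an element of `R` because `f` kills `k`.
  let l : T ⟶ R.obj := hf.lift 0 k (by rw [hk, zero_comp])
  have hl : l ≫ R.p₀ = 0 := hf.lift_fst _ _ _
  refine ⟨kernel.lift R.p₀ l hl ≫ e.hom, ?_⟩
  rw [Category.assoc, he, kernel.lift_ι_assoc]
  exact hf.lift_snd _ _ _

theorem EquivRel.arrow_normalization_comp {C : Type w} [Category.{v} C]
    [HasFiniteLimits C] [HasZeroMorphisms C] {X Y : C} (R : EquivRel X) {f : X ⟶ Y}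
    (hf : IsKernelPair f R.p₀ R.p₁) : R.normalization.arrow ≫ f = 0 := by
  obtain ⟨e, he⟩ := R.exists_iso_kernel
  rw [← cancel_epi e.hom, comp_zero, ← Category.assoc, he, Category.assoc, ← hf.w,
    kernel.condition_assoc, zero_comp]

/-- Effective equivalence relations which commute in the sense of Smith have normalizations
which commute in the sense of Huq. -/
theorem SmithCommute.huqCommute {C : Type w} [Category.{v} C]
    [HasFiniteLimits C] [HasZeroMorphisms C] {X : C} {R S : EquivRel X}
    (hR : R.IsEffective) (hS : S.IsEffective) (h : SmithCommute R.toReflRel S.toReflRel) :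
    HuqCommute R.normalization S.normalization := by
  obtain ⟨Y, f, hf⟩ := hR
  obtain ⟨Z, g, hg⟩ := hS
  obtain ⟨p, hp₁, hp₂⟩ := h
  let a := R.normalization.arrow
  let b := S.normalization.arrow
  have ha : a ≫ f = 0 := R.arrow_normalization_comp hf
  have hb : b ≫ g = 0 := S.arrow_normalization_comp hg
  -- The pairs `(a, 0)` in `R` and `(0, b)` in `S` share the middle entry `0`, so they form the
  -- composable triple `(a, 0, b)`.
  let r : (R.normalization : C) ⟶ R.obj := hf.lift a 0 (by rw [ha, zero_comp])
  let s : (S.normalization : C) ⟶ S.obj := hg.lift 0 b (by rw [hb, zero_comp])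
  have hr₀ : r ≫ R.p₀ = a := hf.lift_fst _ _ _
  have hr₁ : r ≫ R.p₁ = 0 := hf.lift_snd _ _ _
  have hs₀ : s ≫ S.p₀ = 0 := hg.lift_fst _ _ _
  have hs₁ : s ≫ S.p₁ = b := hg.lift_snd _ _ _
  have hrs : (prod.fst ≫ r : (R.normalization : C) ⨯ (S.normalization : C) ⟶ _) ≫ R.p₁ =
      (prod.snd ≫ s) ≫ S.p₀ := by
    rw [Category.assoc, Category.assoc, hr₁, hs₀, comp_zero, comp_zero]
  refine ⟨pullback.lift _ _ hrs ≫ p, ?_, ?_⟩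
  · refine Eq.trans ?_ hr₀
    rw [← hp₂, ← Category.assoc, ← Category.assoc]
    congr 1
    apply pullback.hom_ext
    · rw [Category.assoc, Category.assoc, pullback.lift_fst, pullback.lift_fst,
        prod.lift_fst_assoc, Category.id_comp, Category.comp_id]
    · rw [Category.assoc, Category.assoc, pullback.lift_snd, pullback.lift_snd,
        prod.lift_snd_assoc, zero_comp, reassoc_of% hr₁, zero_comp]
  · refine Eq.trans ?_ hs₁
    rw [← hp₁, ← Category.assoc, ← Category.assoc]
    congr 1
    apply pullback.hom_ext
    · rw [Category.assoc, Category.assoc, pullback.lift_fst, pullback.lift_fst,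
        prod.lift_fst_assoc, zero_comp, reassoc_of% hs₀, zero_comp]
    · rw [Category.assoc, Category.assoc, pullback.lift_snd, pullback.lift_snd,
        prod.lift_snd_assoc, Category.id_comp, Category.comp_id]

/-! ### Schreier split epimorphisms as an order inequality -/

namespace RPOGrp

theorem comp_apply {X Y Z : RPOGrp.{u}} (f : X ⟶ Y) (g : Y ⟶ Z) (x : X) :
    Hom.hom (f ≫ g) x = Hom.hom g (Hom.hom f x) := rfl

theorem id_apply {X : RPOGrp.{u}} (x : X) : Hom.hom (𝟙 X) x = x := rfl

theorem zero_apply {X Y : RPOGrp.{u}} (x : X) : Hom.hom (0 : X ⟶ Y) x = 0 := rfl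

theorem apply_eq_of_eq {X Y : RPOGrp.{u}} {f g : X ⟶ Y} (h : f = g) (x : X) :
    Hom.hom f x = Hom.hom g x := by rw [h]

/-- A group morphism which is nonnegative on the positive cone is a morphism of
right-preordered groups. -/
def homOfNonneg {X Y : RPOGrp.{u}} (f : X →+ Y) (h : ∀ x : X, 0 ≤ x → 0 ≤ f x) : X ⟶ Y :=
  ⟨⟨f, fun x y hxy => by
    -- Right translation by `-x` suffices to pass from `x ≤ y` to `0 ≤ y - x`.
    have := h (y - x) (sub_nonneg.2 hxy)
    rw [map_sub] at this
    exact sub_nonneg.1 this⟩⟩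

/-- A split epimorphism of right-preordered groups is a Schreier one if and only if
`e (d x) ≤ x` for every positive `x`. -/
theorem schreier_iff {X Y : RPOGrp.{u}} (d : X ⟶ Y) (s : SplitEpi d) :
    schreier d s ↔ ∀ x : X, 0 ≤ x → Hom.hom s.section_ (Hom.hom d x) ≤ x := by
  constructor
  · rintro ⟨q, hq, -⟩ x hx
    have h₁ : x = (q ⟨x, hx⟩).1.1 + Hom.hom s.section_ (Hom.hom d x) :=
      congrArg Subtype.val (hq ⟨x, hx⟩)
    have h₂ : 0 ≤ (q ⟨x, hx⟩).1.1 := (q ⟨x, hx⟩).1.2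
    rw [← sub_nonneg]
    rwa [← eq_sub_iff_add_eq.2 h₁.symm]
  · intro h
    refine ⟨fun x => ⟨⟨x.1 - Hom.hom s.section_ (Hom.hom d x.1),
      sub_nonneg.2 (h x.1 x.2)⟩, ?_⟩, ?_, ?_⟩
    · refine AddMonoidHom.mem_mker.2 (Subtype.ext ?_)
      change Hom.hom d (x.1 - Hom.hom s.section_ (Hom.hom d x.1)) = 0
      rw [map_sub, ← comp_apply s.section_ d, s.id, id_apply, sub_self]
    · exact fun x => Subtype.ext (sub_add_cancel x.1 _).symm
    · intro q hq
      funext x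
      refine Subtype.ext (Subtype.ext ?_)
      exact eq_sub_iff_add_eq.2 (congrArg Subtype.val (hq x)).symm

/-- For `x ≥ 0`, apply `e` to `e' (d' (d x)) ≤ d x` and continue with `e (d x) ≤ x`. -/
theorem schreier_closedUnderComp : schreier.{u}.ClosedUnderComp := by
  intro X Y Z d d' s s' h h'
  rw [schreier_iff] at h h' ⊢
  intro x hx
  exact le_trans ((Hom.hom s.section_).monotone' (h' _ (map_nonneg (Hom.hom d) hx))) (h x hx)

/-- The preorder of a binary product is componentwise. -/
theorem le_of_isLimit {X Y P : RPOGrp.{u}} {p₀ : P ⟶ X} {p₁ : P ⟶ Y}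
    (hP : IsLimit (BinaryFan.mk p₀ p₁)) {m n : P} (h₀ : Hom.hom p₀ m ≤ Hom.hom p₀ n)
    (h₁ : Hom.hom p₁ m ≤ Hom.hom p₁ n) : m ≤ n := by
  let f : X ⟶ zeroObj.{u} := 0
  let g : Y ⟶ zeroObj.{u} := 0
  -- The order of the abstract `P` is compared with that of the concrete product, a fibre product
  -- over the trivial group: `φ` is a monotone retraction of `ψ`.
  obtain ⟨φ, hφ₀, hφ₁⟩ := BinaryFan.IsLimit.lift' hP (fibreProdFst f g) (fibreProdSnd f g)
  let ψ : P ⟶ fibreProd f g := (fibreProd_isPullback f g).lift p₀ p₁ rfl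
  have hψ₀ : ψ ≫ fibreProdFst f g = p₀ := IsPullback.lift_fst _ _ _ _
  have hψ₁ : ψ ≫ fibreProdSnd f g = p₁ := IsPullback.lift_snd _ _ _ _
  have h : ψ ≫ φ = 𝟙 P := by
    refine BinaryFan.IsLimit.hom_ext hP ?_ ?_
    · exact (Category.assoc _ _ _).trans
        ((congrArg (ψ ≫ ·) hφ₀).trans (hψ₀.trans (Category.id_comp p₀).symm))
    · exact (Category.assoc _ _ _).trans
        ((congrArg (ψ ≫ ·) hφ₁).trans (hψ₁.trans (Category.id_comp p₁).symm))
  have hmn : Hom.hom ψ m ≤ Hom.hom ψ n := by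
    constructor
    · change Hom.hom (ψ ≫ fibreProdFst f g) m ≤ Hom.hom (ψ ≫ fibreProdFst f g) n
      rwa [hψ₀]
    · change Hom.hom (ψ ≫ fibreProdSnd f g) m ≤ Hom.hom (ψ ≫ fibreProdSnd f g) n
      rwa [hψ₁]
  have := (Hom.hom φ).monotone' hmn
  change Hom.hom (ψ ≫ φ) m ≤ Hom.hom (ψ ≫ φ) n at this
  rwa [h] at this

/-- The Schreier inequality reads `(0, x₁) ≤ (x₀, x₁)` for `x₀ ≥ 0`, checked on components. -/
theorem schreier_containsProductProjections : schreier.{u}.ContainsProductProjections := by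
  rintro X Y P p₀ p₁ ⟨hP⟩ i hi₀ hi₁
  rw [schreier_iff]
  intro x hx
  refine le_of_isLimit hP ?_ ?_
  · rw [← comp_apply i, hi₀, zero_apply]
    exact map_nonneg (Hom.hom p₀) hx
  · rw [← comp_apply i, hi₁, id_apply]

/-! ### Huq implies Smith -/

/-- If two morphisms to `Z` cooperate, the elements of their images commute. -/
theorem add_comm_of_prod {A B Z : RPOGrp.{u}} (φ : A ⨯ B ⟶ Z) (a : A) (b : B) :
    Hom.hom (prod.lift (𝟙 A) 0 ≫ φ) a + Hom.hom (prod.lift 0 (𝟙 B) ≫ φ) b =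
      Hom.hom (prod.lift 0 (𝟙 B) ≫ φ) b + Hom.hom (prod.lift (𝟙 A) 0 ≫ φ) a := by
  let f : A ⟶ zeroObj.{u} := 0
  let g : B ⟶ zeroObj.{u} := 0
  let ψ : fibreProd f g ⟶ Z := prod.lift (fibreProdFst f g) (fibreProdSnd f g) ≫ φ
  let i : A ⟶ fibreProd f g := (fibreProd_isPullback f g).lift (𝟙 A) 0 rfl
  let j : B ⟶ fibreProd f g := (fibreProd_isPullback f g).lift 0 (𝟙 B) rfl
  have hi₀ : i ≫ fibreProdFst f g = 𝟙 A := IsPullback.lift_fst _ _ _ _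
  have hi₁ : i ≫ fibreProdSnd f g = 0 := IsPullback.lift_snd _ _ _ _
  have hj₀ : j ≫ fibreProdFst f g = 0 := IsPullback.lift_fst _ _ _ _
  have hj₁ : j ≫ fibreProdSnd f g = 𝟙 B := IsPullback.lift_snd _ _ _ _
  have hi : prod.lift (𝟙 A) 0 ≫ φ = i ≫ ψ := by
    simp only [ψ, prod.comp_lift_assoc, hi₀, hi₁]
  have hj : prod.lift 0 (𝟙 B) ≫ φ = j ≫ ψ := by
    simp only [ψ, prod.comp_lift_assoc, hj₀, hj₁]
  -- In the concrete product, `(a, 0)` and `(0, b)` commute componentwise; `ψ` carries this to `Z`.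
  have hij : Hom.hom i a + Hom.hom j b = Hom.hom j b + Hom.hom i a := by
    refine Subtype.ext (Prod.ext ?_ ?_)
    · change Hom.hom (i ≫ fibreProdFst f g) a + Hom.hom (j ≫ fibreProdFst f g) b =
        Hom.hom (j ≫ fibreProdFst f g) b + Hom.hom (i ≫ fibreProdFst f g) a
      rw [hj₀, zero_apply, add_zero, zero_add]
    · change Hom.hom (i ≫ fibreProdSnd f g) a + Hom.hom (j ≫ fibreProdSnd f g) b =
        Hom.hom (j ≫ fibreProdSnd f g) b + Hom.hom (i ≫ fibreProdSnd f g) a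
      rw [hi₁, zero_apply, add_zero, zero_add]
  rw [hi, hj, comp_apply i ψ, comp_apply j ψ, ← map_add, hij, map_add]

/-- The elements of the kernel of `f` come from the normalization of the kernel pair of `f`. -/
theorem exists_arrow_normalization_eq {X Y : RPOGrp.{u}} (R : EquivRel X) {f : X ⟶ Y}
    (hf : IsKernelPair f R.p₀ R.p₁) (x : X) (hx : Hom.hom f x = 0) :
    ∃ a : (R.normalization : RPOGrp.{u}), Hom.hom R.normalization.arrow a = x := by
  -- The pullback of `f` along `z` is a concrete kernel of `f`, with `x` among its elements.
  let z : zeroObj.{u} ⟶ Y := 0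
  obtain ⟨t, ht⟩ := R.exists_comp_arrow_normalization hf (fibreProdFst f z)
    (by rw [(fibreProd_isPullback f z).w]; exact comp_zero)
  exact ⟨Hom.hom t ⟨(x, 0), hx⟩, apply_eq_of_eq ht _⟩

theorem add_comm_of_huqCommute {X Y Z : RPOGrp.{u}} {R S : EquivRel X} {f : X ⟶ Y}
    {g : X ⟶ Z} (hf : IsKernelPair f R.p₀ R.p₁) (hg : IsKernelPair g S.p₀ S.p₁)
    (h : HuqCommute R.normalization S.normalization) {x y : X} (hx : Hom.hom f x = 0)
    (hy : Hom.hom g y = 0) : x + y = y + x := by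
  obtain ⟨φ, hφ₁, hφ₂⟩ := h
  obtain ⟨a, rfl⟩ := exists_arrow_normalization_eq R hf x hx
  obtain ⟨b, rfl⟩ := exists_arrow_normalization_eq S hg y hy
  rw [← hφ₁, ← hφ₂]
  exact add_comm_of_prod φ a b

/-- The Mal'tsev operation `x - y + z` is additive on triples whose differences commute. -/
theorem sub_add_add_of_commute {G : Type*} [AddGroup G] {x y z x' y' z' : G}
    (h : (x' - y') + (-y + z) = (-y + z) + (x' - y')) :
    (x + x') - (y + y') + (z + z') = (x - y + z) + (x' - y' + z') := by
  -- Since `-(y + y') = -y' + -y`, the term `x' - y'` lands next to `-y + z`; one swap suffices.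
  calc (x + x') - (y + y') + (z + z')
      = x + ((x' - y') + (-y + z)) + z' := by
        simp only [sub_eq_add_neg, neg_add_rev, add_assoc]
    _ = (x - y + z) + (x' - y' + z') := by
        rw [h]; simp only [sub_eq_add_neg, add_assoc]

theorem smithCommute_of_huqCommute {X : RPOGrp.{u}} {R S : EquivRel X}
    (hR : R.IsClassEffective schreier) (hS : S.IsClassEffective schreier)
    (h : HuqCommute R.normalization S.normalization) :
    SmithCommute R.toReflRel S.toReflRel := by
  obtain ⟨⟨Y, f, hf⟩, -, hR₁⟩ := hR
  obtain ⟨⟨Z, g, hg⟩, -, -⟩ := hS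
  rw [schreier_iff] at hR₁
  let r : pullback R.p₁ S.p₀ ⟶ R.obj := pullback.fst _ _
  let s : pullback R.p₁ S.p₀ ⟶ S.obj := pullback.snd _ _
  have hrs (t) : Hom.hom (r ≫ R.p₁) t = Hom.hom (s ≫ S.p₀) t :=
    apply_eq_of_eq pullback.condition t
  have hfr (t) : Hom.hom f (Hom.hom (r ≫ R.p₀) t - Hom.hom (r ≫ R.p₁) t) = 0 := by
    rw [map_sub, sub_eq_zero]
    exact apply_eq_of_eq hf.w (Hom.hom r t)
  have hgs (t) : Hom.hom g (-Hom.hom (r ≫ R.p₁) t + Hom.hom (s ≫ S.p₁) t) = 0 := by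
    rw [map_add, map_neg, neg_add_eq_zero, hrs]
    exact apply_eq_of_eq hg.w (Hom.hom s t)
  -- For positive `q = (x, y)`, the Schreier inequality is `(y, y) ≤ (x, y)`; applying `p₀` gives `y
  -- ≤ x`.
  have hle (q : R.obj) (hq : 0 ≤ q) : Hom.hom R.p₁ q ≤ Hom.hom R.p₀ q := by
    have := (Hom.hom R.p₀).monotone' (hR₁ q hq)
    change Hom.hom (R.diag ≫ R.p₀) (Hom.hom R.p₁ q) ≤ _ at this
    rwa [R.diag_p₀] at this
  let m : ↥(pullback R.p₁ S.p₀) →+ X := AddMonoidHom.mk'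
    (fun t => Hom.hom (r ≫ R.p₀) t - Hom.hom (r ≫ R.p₁) t + Hom.hom (s ≫ S.p₁) t)
    (fun t t' => by
      rw [map_add, map_add, map_add]
      exact sub_add_add_of_commute (add_comm_of_huqCommute hf hg h (hfr t') (hgs t)))
  -- For a positive triple, `x - y` and `z` are both positive, hence so is their sum.
  refine ⟨homOfNonneg m fun t ht => X.posCone.add_mem
    (sub_nonneg.2 (hle _ (map_nonneg (Hom.hom r) ht))) (map_nonneg (Hom.hom (s ≫ S.p₁)) ht),
    hom_ext fun y => ?_, hom_ext fun y => ?_⟩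
  · let l : S.obj ⟶ pullback R.p₁ S.p₀ := pullback.lift (S.p₀ ≫ R.diag) (𝟙 S.obj)
      (by rw [Category.assoc, R.diag_p₁, Category.comp_id, Category.id_comp])
    have hlr : l ≫ r = S.p₀ ≫ R.diag := pullback.lift_fst _ _ _
    have hls : l ≫ s = 𝟙 S.obj := pullback.lift_snd _ _ _
    have h₀ : l ≫ r ≫ R.p₀ = l ≫ r ≫ R.p₁ := by
      rw [reassoc_of% hlr, reassoc_of% hlr, R.diag_p₀, R.diag_p₁]
    have h₁ : l ≫ s ≫ S.p₁ = S.p₁ := by rw [reassoc_of% hls]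
    change Hom.hom (l ≫ r ≫ R.p₀) y - Hom.hom (l ≫ r ≫ R.p₁) y +
      Hom.hom (l ≫ s ≫ S.p₁) y = _
    rw [h₀, h₁, sub_self, zero_add]
  · let l : R.obj ⟶ pullback R.p₁ S.p₀ := pullback.lift (𝟙 R.obj) (R.p₁ ≫ S.diag)
      (by rw [Category.assoc, S.diag_p₀, Category.comp_id, Category.id_comp])
    have hlr : l ≫ r = 𝟙 R.obj := pullback.lift_fst _ _ _
    have hls : l ≫ s = R.p₁ ≫ S.diag := pullback.lift_snd _ _ _
    have h₀ : l ≫ r ≫ R.p₀ = R.p₀ := by rw [reassoc_of% hlr]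
    have h₁ : l ≫ r ≫ R.p₁ = l ≫ s ≫ S.p₁ := by
      rw [reassoc_of% hlr, reassoc_of% hls, S.diag_p₁, Category.comp_id]
    change Hom.hom (l ≫ r ≫ R.p₀) y - Hom.hom (l ≫ r ≫ R.p₁) y +
      Hom.hom (l ≫ s ≫ S.p₁) y = _
    rw [h₀, h₁, sub_add_cancel]

theorem schreier_smithIsHuq : schreier.{u}.SmithIsHuq := fun _ _ _ hR hS =>
  ⟨fun h => h.huqCommute hR.1 hS.1, smithCommute_of_huqCommute hR hS⟩

end RPOGrp

theorem mainTheorem12 :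
    RPOGrp.schreier.{u}.ClosedUnderComp ∧
      RPOGrp.schreier.{u}.ContainsProductProjections ∧
      RPOGrp.schreier.{u}.SmithIsHuq :=
  ⟨RPOGrp.schreier_closedUnderComp, RPOGrp.schreier_containsProductProjections,
    RPOGrp.schreier_smithIsHuq⟩
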